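/- For a finite set $S$ of points in the Euclidean plane let $\mathrm{ch}(S)$ be its convex hull and $\mathrm{per}(S)$ the perimeter of $\mathrm{ch}(S)$, that is, the total length of the edges of the hull when its boundary is traversed once counterclockwise (so the perimeter of a segment is twice its length, and that of a point is $0$). A bipartition of a finite planar point set $P$ is a pair $(P_1,P_2)$ of disjoint nonempty sets with $P_1\cup P_2=P$. Theorem. Let $P$ be a finite set of points in the plane, and let $(P_1,P_2)$ be a bipartition of $P$ that minimizes $\mathrm{per}(P_1)+\mathrm{per}(P_2)$ among all bipartitions of $P$. Then $\mathrm{ch}(P_1)$ and $\mathrm{ch}(P_2)$ are disjoint, so that they have two inner common tangents $\ell_1,\ell_2$ (lines that touch both hulls and weakly separate them). These define four wedges: one containing $P_1$, one containing $P_2$, and two empty ones; the opening angle of the empty wedges is called the separation angle (if all points of $P$ lie on one line, both tangents are that line, and the separation angle is $\pi$). Moreover, the separation angle is at least $\pi/6$, or the distance between $\mathrm{ch}(P_1)$ and $\mathrm{ch}(P_2)$ is at least $\frac{1}{250}\cdot\min(\mathrm{per}(P_1),\mathrm{per}(P_2))$. -/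

import Mathlib

/-- The Euclidean plane. -/
abbrev Plane : Type := EuclideanSpace ℝ (Fin 2)

/-- The determinant of two plane vectors. It is positive iff `w` points to the left of `v`,
negative iff `w` points to the right of `v`, and zero iff the two vectors are parallel. -/
def det2 (v w : Plane) : ℝ := v 0 * w 1 - v 1 * w 0

/-- `(p, q)` is an edge of the convex hull of the finite point set `S`, directed counterclockwise:
`p ≠ q` are points of `S`, no point of `S` lies strictly to the right of the line from `p` to `q`,
and the points of `S` on that line all lie between `p` and `q` (so that `p` and `q` are
consecutive vertices of the hull). -/
def IsHullEdge (S : Finset Plane) (p q : Plane) : Prop :=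
  p ∈ S ∧ q ∈ S ∧ p ≠ q ∧
    ∀ x ∈ S, 0 ≤ det2 (q - p) (x - p) ∧ (det2 (q - p) (x - p) = 0 → x ∈ segment ℝ p q)

open Classical in
/-- The perimeter of the convex hull of the finite point set `S`: the total length of the
counterclockwise directed boundary edges. A hull that is a segment has the two directed edges
`(p, q)` and `(q, p)`, so its perimeter is twice its length; a point has perimeter zero. -/
noncomputable def per (S : Finset Plane) : ℝ :=
  ∑ e ∈ (S ×ˢ S).filter (fun e => IsHullEdge S e.1 e.2), dist e.1 e.2

/-- `(P₁, P₂)` is a partition of `P` into two nonempty parts. -/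
def IsBipartition (P P₁ P₂ : Finset Plane) : Prop :=
  P₁.Nonempty ∧ P₂.Nonempty ∧ Disjoint P₁ P₂ ∧ (P₁ : Set Plane) ∪ P₂ = P

/-- `(P₁, P₂)` is a bipartition of `P` that minimizes the sum of the perimeters of the hulls,
among all bipartitions of `P`. -/
def IsMinPerimeterSum (P P₁ P₂ : Finset Plane) : Prop :=
  IsBipartition P P₁ P₂ ∧ ∀ Q₁ Q₂, IsBipartition P Q₁ Q₂ → per P₁ + per P₂ ≤ per Q₁ + per Q₂

/-- The line through `a` with unit direction `d` is an inner common tangent of `A` and `B`,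
directed so that `A` lies to its left and `B` to its right: it touches both sets and it
separates them (weakly). -/
def IsInnerTangent (A B : Set Plane) (a d : Plane) : Prop :=
  ‖d‖ = 1 ∧
    (∀ x ∈ A, 0 ≤ det2 d (x - a)) ∧ (∀ y ∈ B, det2 d (y - a) ≤ 0) ∧
    (∃ x ∈ A, det2 d (x - a) = 0) ∧ (∃ y ∈ B, det2 d (y - a) = 0)

/-- `β` is the separation angle of `A` and `B`: the opening angle of the empty wedges formed by the
two inner common tangents. When both tangents are directed so that `A` lies to the left and `B` to
the right, one empty wedge is bounded by the two forward rays from their crossing point, and the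
other one by the two backward rays; both have the angle between the two directions as opening angle.
If the two tangents are one and the same line (then it contains `A` and `B`), this line arises with
its two opposite directions, the empty wedges are its two half-planes, and the angle is `π`. -/
def IsSeparationAngle (A B : Set Plane) (β : ℝ) : Prop :=
  ∃ a₁ d₁ a₂ d₂, IsInnerTangent A B a₁ d₁ ∧ IsInnerTangent A B a₂ d₂ ∧ d₁ ≠ d₂ ∧
    β = InnerProductGeometry.angle d₁ d₂

/-- The distance between two (nonempty) sets. -/
noncomputable def sepDist (A B : Set Plane) : ℝ :=
  sInf {r | ∃ x ∈ A, ∃ y ∈ B, r = dist x y}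

/-! Everything is expressed through support functions. By Cauchy's formula (`per_eq_integral`) the
perimeter is the integral of the support function over all directions. The support function of a
union is the maximum, so merging `S` and `T` saves `∫ min (h_S, h_T)` (`per_add_per_sub_per_union`).
Splitting off a suitable single point is strictly cheaper than one hull around `P`, so for a minimal
bipartition this integral is negative (`integral_min_supportFn_neg`); nothing else about minimality
is used.

A common point of the hulls would bound the minimum below by a pure sinusoid, whose integral is
zero; hence the hulls are disjoint.

Now let the separation angle `β` be less than `π / 6`, take the crossing point `o` of the tangents
as origin, and let `r₁ ≤ r₂` be the distances of the two hulls from `o`. The minimum can be negative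
only on two arcs of length `β`, which cost at most `β (r₁ + r₂)`. The points where the hulls touch
the tangents make it positive elsewhere (`le_integral_min`). Negativity of the total first makes
`r₁` small compared with `r₂`, and then keeps every point of the nearer hull within `9/10 r₂` of `o`
(`radius_le_of_integral_min_neg`). So that hull has perimeter `O(r₂)`, while the gap is at least `r₂
/ 10`. -/

/-- The component of a plane vector in the direction of angle `θ`, as a linear functional. -/
noncomputable def dirDot (θ : ℝ) : Plane →ₗ[ℝ] ℝ where
  toFun x := x 0 * Real.cos θ + x 1 * Real.sin θ
  map_add' x y := by simp; ring
  map_smul' c x := by simp; ring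

theorem dirDot_apply (θ : ℝ) (x : Plane) : dirDot θ x = x 0 * Real.cos θ + x 1 * Real.sin θ := rfl

theorem det2_eq_dirDot (θ : ℝ) (v w : Plane) :
    det2 v w = dirDot θ v * dirDot (θ + Real.pi / 2) w - dirDot (θ + Real.pi / 2) v * dirDot θ w := by
  simp only [det2, dirDot_apply, Real.cos_add_pi_div_two, Real.sin_add_pi_div_two]
  linear_combination (- v 0 * w 1 + v 1 * w 0) * Real.sin_sq_add_cos_sq θ

/-! ### Hull edges crossed by a line, and the projection of a hull -/

section Crossing

variable {f g : Plane →ₗ[ℝ] ℝ}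

/-- `f` and `g` are the coordinates of a positively oriented orthonormal frame, up to shear. -/
def IsFrame (f g : Plane →ₗ[ℝ] ℝ) : Prop := ∀ v w, det2 v w = f v * g w - g v * f w

theorem IsFrame.ext (h : IsFrame f g) {v w : Plane} (hf : f v = f w) (hg : g v = g w) : v = w := by
  have key : ∀ z, det2 (v - w) z = 0 := fun z => by rw [h]; simp [hf, hg]
  have h0 := key !₂[1, 0]
  have h1 := key !₂[0, 1]
  simp [det2, sub_eq_zero] at h0 h1
  ext i
  fin_cases i <;> simp [h0, h1]

/-- The `g`-coordinate at which the line through `p` and `q` has `f`-coordinate `t`. -/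
noncomputable def crossing (f g : Plane →ₗ[ℝ] ℝ) (t : ℝ) (e : Plane × Plane) : ℝ :=
  g e.1 + (t - f e.1) / (f e.2 - f e.1) * (g e.2 - g e.1)

theorem crossing_spec {t : ℝ} {p q : Plane} (h : f p < f q) :
    (f q - f p) * crossing f g t (p, q) = (f q - t) * g p + (t - f p) * g q := by
  have : f q - f p ≠ 0 := by linarith
  simp only [crossing]
  field_simp
  ring

theorem crossing_le_iff {t : ℝ} {p q : Plane} (h : f p < f q) (c : ℝ) :
    c ≤ crossing f g t (p, q) ↔ (f q - f p) * c ≤ (f q - t) * g p + (t - f p) * g q := by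
  rw [← crossing_spec h]
  exact (mul_le_mul_iff_right₀ (by linarith)).symm

/-- Among all segments between points of `S` that straddle the level `t`, the one crossing it lowest
supports the hull from below; the longest such segment is the whole edge. -/
theorem exists_hullEdge_crossing (hfg : IsFrame f g) {S : Finset Plane} {t : ℝ}
    (ht : ∀ x ∈ S, f x ≠ t) (hlo : ∃ x ∈ S, f x < t) (hhi : ∃ x ∈ S, t < f x) :
    ∃ p q, IsHullEdge S p q ∧ f p < t ∧ t < f q := by
  classical
  set T := (S ×ˢ S).filter (fun e => f e.1 < t ∧ t < f e.2) with hT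
  obtain ⟨x, hx, hxt⟩ := hlo
  obtain ⟨y, hy, hyt⟩ := hhi
  have hTne : T.Nonempty := ⟨(x, y), by simp [hT, hx, hy, hxt, hyt]⟩
  obtain ⟨e0, he0, hmin⟩ := T.exists_min_image (crossing f g t) hTne
  set U := T.filter (fun e => crossing f g t e = crossing f g t e0) with hU
  -- The tie-break by length matters when more than two points lie on the edge line: it selects the
  -- extreme ones.
  obtain ⟨⟨p, q⟩, he, hmax⟩ := U.exists_max_image (fun e => f e.2 - f e.1) ⟨e0, by simp [hU, he0]⟩
  simp only [hU, hT, Finset.mem_filter, Finset.mem_product] at he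
  obtain ⟨⟨⟨hp, hq⟩, hpt, hqt⟩, heq⟩ := he
  have hpq : f p < f q := hpt.trans hqt
  have hsp := crossing_spec (f := f) (g := g) (t := t) hpq
  rw [heq] at hsp
  set c := crossing f g t e0
  have hminT : ∀ a ∈ S, ∀ b ∈ S, f a < t → t < f b → c ≤ crossing f g t (a, b) :=
    fun a ha b hb h1 h2 => hmin _ (by simp [hT, ha, hb, h1, h2])
  have hmaxT : ∀ a ∈ S, ∀ b ∈ S, f a < t → t < f b →
      (f b - f a) * c = (f b - t) * g a + (t - f a) * g b → f b - f a ≤ f q - f p := by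
    intro a ha b hb h1 h2 h3
    refine hmax (a, b) ?_
    have : crossing f g t (a, b) = c := by
      have h4 := crossing_spec (f := f) (g := g) (t := t) (h1.trans h2)
      rw [← h3] at h4
      exact mul_left_cancel₀ (by linarith) h4
    simp [hU, hT, ha, hb, h1, h2, this]
  refine ⟨p, q, ⟨hp, hq, fun h => by simp [h] at hpq, fun x hx => ⟨?_, fun h0 => ?_⟩⟩, hpt, hqt⟩
  · rw [hfg]
    simp only [map_sub]
    rcases lt_or_gt_of_ne (ht x hx) with h | h
    · have h1 := (crossing_le_iff (h.trans hqt) c).1 (hminT x hx q hq h hqt)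
      have h2 : 0 ≤ (f q - t) * ((f q - f p) * (g x - g p) - (g q - g p) * (f x - f p)) := by
        nlinarith [mul_le_mul_of_nonneg_left h1 (by linarith : 0 ≤ f q - f p),
          congrArg (fun z => (f q - f x) * z) hsp]
      exact nonneg_of_mul_nonneg_right h2 (by linarith)
    · have h1 := (crossing_le_iff (hpt.trans h) c).1 (hminT p hp x hx hpt h)
      have h2 : 0 ≤ (t - f p) * ((f q - f p) * (g x - g p) - (g q - g p) * (f x - f p)) := by
        nlinarith [mul_le_mul_of_nonneg_left h1 (by linarith : 0 ≤ f q - f p),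
          congrArg (fun z => (f x - f p) * z) hsp]
      exact nonneg_of_mul_nonneg_right h2 (by linarith)
  · rw [hfg] at h0
    simp only [map_sub] at h0
    have hlo : f p ≤ f x := by
      by_contra! h
      have := hmaxT x hx q hq (h.trans hpt) hqt (by
        refine mul_left_cancel₀ (by linarith : f q - f p ≠ 0) ?_
        linear_combination (f q - f x) * hsp - (f q - t) * h0)
      linarith
    have hhi : f x ≤ f q := by
      by_contra! h
      have := hmaxT p hp x hx hpt (hqt.trans h) (by
        refine mul_left_cancel₀ (by linarith : f q - f p ≠ 0) ?_
        linear_combination (f x - f p) * hsp - (t - f p) * h0)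
      linarith
    have hd : f q - f p ≠ 0 := by linarith
    refine ⟨(f q - f x) / (f q - f p), (f x - f p) / (f q - f p),
      div_nonneg (by linarith) (by linarith), div_nonneg (by linarith) (by linarith),
      by field_simp; ring, hfg.ext ?_ ?_⟩
    · simp only [map_add, map_smul, smul_eq_mul]
      field_simp
      ring
    · simp only [map_add, map_smul, smul_eq_mul]
      field_simp
      linear_combination -h0

/-- The difference of the two crossing heights is, up to a positive factor, a positive combination
of the determinants of `a` and `b` against the edge. Equality makes both vanish, so `a` and `b` lie
on the edge. Uniqueness of the crossed edge follows by symmetry. -/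
theorem IsHullEdge.crossing_le (hfg : IsFrame f g) {S : Finset Plane} {p q a b : Plane}
    (h : IsHullEdge S p q) (ha : a ∈ S) (hb : b ∈ S) {t : ℝ} (hp : f p < t) (hq : t < f q)
    (hat : f a < t) (hbt : t < f b) :
    crossing f g t (p, q) ≤ crossing f g t (a, b) ∧
      (crossing f g t (p, q) = crossing f g t (a, b) → f p ≤ f a ∧ f b ≤ f q ∧
        (f a = f p → a = p) ∧ (f b = f q → b = q)) := by
  have ha' := h.2.2.2 a ha
  have hb' := h.2.2.2 b hb
  have e1 := crossing_spec (f := f) (g := g) (t := t) (hp.trans hq)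
  have e2 := crossing_spec (f := f) (g := g) (t := t) (hat.trans hbt)
  set c := crossing f g t (p, q)
  set c' := crossing f g t (a, b)
  have hda := hfg (q - p) (a - p)
  have hdb := hfg (q - p) (b - p)
  set A := det2 (q - p) (a - p)
  set B := det2 (q - p) (b - p)
  simp only [map_sub] at hda hdb
  have key : (f q - f p) * (f b - f a) * (c' - c) = (f b - t) * A + (t - f a) * B := by
    rw [hda, hdb]
    linear_combination (f q - f p) * e2 - (f b - f a) * e1
  have hpos : 0 < (f q - f p) * (f b - f a) := mul_pos (by linarith) (by linarith)
  have hA : 0 ≤ (f b - t) * A := mul_nonneg (by linarith) ha'.1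
  have hB : 0 ≤ (t - f a) * B := mul_nonneg (by linarith) hb'.1
  refine ⟨?_, fun hcc => ?_⟩
  · by_contra! hlt
    nlinarith
  · rw [hcc, sub_self, mul_zero] at key
    have hA0 : A = 0 := by
      have : (f b - t) * A = 0 := by linarith
      exact (mul_eq_zero.1 this).resolve_left (by linarith)
    have hB0 : B = 0 := by
      have : (t - f a) * B = 0 := by linarith
      exact (mul_eq_zero.1 this).resolve_left (by linarith)
    have bounds : ∀ x ∈ segment ℝ p q, f p ≤ f x ∧ f x ≤ f q := by
      rintro x ⟨μ, ν, hμ, hν, hs, rfl⟩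
      simp only [map_add, map_smul, smul_eq_mul]
      obtain rfl : μ = 1 - ν := by linarith
      constructor <;> nlinarith
    refine ⟨(bounds a (ha'.2 hA0)).1, (bounds b (hb'.2 hB0)).2, fun he => hfg.ext he ?_,
      fun he => hfg.ext he ?_⟩
    · rw [hA0, he] at hda
      have : (f q - f p) * (g a - g p) = 0 := by linarith
      linarith [(mul_eq_zero.1 this).resolve_left (by linarith)]
    · rw [hB0, he] at hdb
      have : (f q - f p) * (g b - g q) = 0 := by linarith
      linarith [(mul_eq_zero.1 this).resolve_left (by linarith)]

theorem hullEdge_crossing_unique (hfg : IsFrame f g) {S : Finset Plane} {p q a b : Plane}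
    (h : IsHullEdge S p q) (h' : IsHullEdge S a b) {t : ℝ} (hp : f p < t) (hq : t < f q)
    (ha : f a < t) (hb : t < f b) : p = a ∧ q = b := by
  obtain ⟨h1, h2⟩ := h.crossing_le hfg h'.1 h'.2.1 hp hq ha hb
  obtain ⟨h3, h4⟩ := h'.crossing_le hfg h.1 h.2.1 ha hb hp hq
  have he := le_antisymm h1 h3
  obtain ⟨k1, k2, k3, k4⟩ := h2 he
  obtain ⟨l1, l2, l3, l4⟩ := h4 he.symm
  exact ⟨l3 (le_antisymm k1 l1), l4 (le_antisymm l2 k2)⟩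

open Classical MeasureTheory in
/-- The hull edges that ascend in the direction of `f` climb from the lowest to the highest point. -/
theorem sum_hullEdge_max (hfg : IsFrame f g) {S : Finset Plane} (hS : S.Nonempty) :
    ∑ e ∈ (S ×ˢ S).filter (fun e => IsHullEdge S e.1 e.2), max (f (e.2 - e.1)) 0 =
      S.sup' hS f - S.inf' hS f := by
  set E := (S ×ˢ S).filter (fun e => IsHullEdge S e.1 e.2) with hE
  obtain ⟨hi, hhi, hhie⟩ := S.exists_mem_eq_sup' hS f
  obtain ⟨lo, hlo, hloe⟩ := S.exists_mem_eq_inf' hS f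
  have hle : ∀ x ∈ S, f x ≤ f hi := fun x hx => hhie ▸ Finset.le_sup' f hx
  have hge : ∀ x ∈ S, f lo ≤ f x := fun x hx => hloe ▸ Finset.inf'_le f hx
  have hvol : ∀ e : Plane × Plane, max (f (e.2 - e.1)) 0 = volume.real (Set.Ioo (f e.1) (f e.2)) := by
    intro e
    simp [Measure.real, Real.volume_Ioo, ENNReal.toReal_ofReal', map_sub]
  -- Each ascent is the length of an open interval of levels; these intervals are disjoint and fill
  -- the range of `f` on the hull up to a null set.
  rw [hhie, hloe, Finset.sum_congr rfl (fun e _ => hvol e),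
    ← measureReal_biUnion_finset (μ := volume) (s := E) (f := fun e => Set.Ioo (f e.1) (f e.2))
      (h := fun e _ => by simp [Real.volume_Ioo])]
  · have hlh : f lo ≤ f hi := hge _ hhi
    have : volume.real (Set.Ioo (f lo) (f hi)) = f hi - f lo := by
      simp [Measure.real, Real.volume_Ioo, hlh]
    rw [← this]
    refine measureReal_congr (ae_eq_set.2 ⟨?_, ?_⟩)
    · convert measure_empty (μ := volume (α := ℝ))
      rw [Set.sdiff_eq_empty]
      refine Set.iUnion₂_subset fun e he => Set.Ioo_subset_Ioo ?_ ?_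
      · exact hge _ (Finset.mem_product.1 (Finset.mem_filter.1 he).1).1
      · exact hle _ (Finset.mem_product.1 (Finset.mem_filter.1 he).1).2
    -- Only the finitely many levels of points of `S` can be missed.
    · refine measure_mono_null (t := f '' (S : Set Plane)) ?_
        ((S.finite_toSet.image f).measure_zero _)
      rintro t ⟨⟨h1, h2⟩, h3⟩
      by_contra h4
      obtain ⟨p, q, he, hp, hq⟩ := exists_hullEdge_crossing hfg (S := S) (t := t)
        (fun x hx hxt => h4 ⟨x, hx, hxt⟩) ⟨lo, hlo, h1⟩ ⟨hi, hhi, h2⟩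
      exact h3 (Set.mem_biUnion (x := (p, q)) (by simp [hE, he, he.1, he.2.1]) ⟨hp, hq⟩)
  · intro e he e' he' hne
    refine Set.disjoint_left.2 fun t ht ht' => hne ?_
    have := hullEdge_crossing_unique hfg (Finset.mem_filter.1 he).2 (Finset.mem_filter.1 he').2
      ht.1 ht.2 ht'.1 ht'.2
    exact Prod.ext this.1 this.2
  · exact fun _ _ => measurableSet_Ioo

end Crossing

/-! ### Polar coordinates and integrals over directions -/

open Real intervalIntegral

theorem isFrame_dirDot (θ : ℝ) : IsFrame (dirDot θ) (dirDot (θ + π / 2)) := det2_eq_dirDot θ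

/-- Polar coordinates in a frame rotated by `γ`. -/
theorem exists_polar (γ : ℝ) (x : Plane) :
    ∃ ψ, -π < ψ ∧ ψ ≤ π ∧ ∀ θ, dirDot θ x = ‖x‖ * cos (θ - γ - ψ) := by
  set z : ℂ := ⟨dirDot γ x, dirDot (γ + π / 2) x⟩ with hz
  have hnorm : ‖z‖ = ‖x‖ := by
    rw [EuclideanSpace.norm_eq, Complex.norm_def, Complex.normSq_apply]
    congr 1
    simp only [hz, dirDot_apply, Fin.sum_univ_two, norm_eq_abs, sq_abs, cos_add_pi_div_two,
      sin_add_pi_div_two]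
    linear_combination (x 0 ^ 2 + x 1 ^ 2) * sin_sq_add_cos_sq γ
  refine ⟨z.arg, Complex.neg_pi_lt_arg z, Complex.arg_le_pi z, fun θ => ?_⟩
  have h1 : dirDot γ x = ‖x‖ * cos z.arg := by rw [← hnorm, Complex.norm_mul_cos_arg]
  have h2 : dirDot (γ + π / 2) x = ‖x‖ * sin z.arg := by rw [← hnorm, Complex.norm_mul_sin_arg]
  rw [cos_sub (θ - γ), cos_sub, sin_sub, mul_add]
  have : ‖x‖ * ((cos θ * cos γ + sin θ * sin γ) * cos z.arg) +
      ‖x‖ * ((sin θ * cos γ - cos θ * sin γ) * sin z.arg) =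
      (cos θ * cos γ + sin θ * sin γ) * dirDot γ x +
      (sin θ * cos γ - cos θ * sin γ) * dirDot (γ + π / 2) x := by rw [h1, h2]; ring
  rw [this]
  simp only [dirDot_apply, cos_add_pi_div_two, sin_add_pi_div_two]
  linear_combination -(x 0 * cos θ + x 1 * sin θ) * sin_sq_add_cos_sq γ

theorem dirDot_le_norm (θ : ℝ) (x : Plane) : dirDot θ x ≤ ‖x‖ := by
  obtain ⟨ψ, -, -, h⟩ := exists_polar 0 x
  rw [h]
  exact mul_le_of_le_one_right (norm_nonneg x) (cos_le_one _)

theorem continuous_dirDot (x : Plane) : Continuous fun θ => dirDot θ x := by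
  simp only [dirDot_apply]
  fun_prop

theorem periodic_dirDot (x : Plane) : Function.Periodic (fun θ => dirDot θ x) (2 * π) := by
  intro θ
  simp [dirDot_apply]

theorem dirDot_add_pi (θ : ℝ) (x : Plane) : dirDot (θ + π) x = - dirDot θ x := by
  rw [dirDot_apply, dirDot_apply, cos_add_pi, sin_add_pi]; ring

theorem integral_max_dirDot (x : Plane) : ∫ θ in 0..2 * π, max (dirDot θ x) 0 = 2 * ‖x‖ := by
  obtain ⟨ψ, -, -, h⟩ := exists_polar 0 x
  have hc : Continuous fun θ => max (dirDot θ x) 0 := (continuous_dirDot x).max continuous_const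
  have hp : Function.Periodic (fun θ => max (dirDot θ x) 0) (2 * π) := fun θ => by
    simp only [periodic_dirDot x θ]
  -- Shifting the period makes the half on which the cosine is positive a single interval.
  have h1 := hp.intervalIntegral_add_eq 0 (ψ - π / 2)
  rw [zero_add] at h1
  rw [h1, ← integral_add_adjacent_intervals (b := ψ + π / 2) (hc.intervalIntegrable _ _)
    (hc.intervalIntegrable _ _)]
  have e1 : ∫ θ in (ψ - π / 2)..(ψ + π / 2), max (dirDot θ x) 0 =
      ∫ θ in (ψ - π / 2)..(ψ + π / 2), ‖x‖ * cos (θ - ψ) := by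
    refine integral_congr fun θ hθ => ?_
    rw [Set.uIcc_of_le (by linarith [pi_pos])] at hθ
    simp only [h, sub_zero]
    exact max_eq_left (mul_nonneg (norm_nonneg _)
      (cos_nonneg_of_mem_Icc ⟨by linarith [hθ.1], by linarith [hθ.2]⟩))
  have e2 : ∫ θ in (ψ + π / 2)..(ψ - π / 2 + 2 * π), max (dirDot θ x) 0 =
      ∫ θ in (ψ + π / 2)..(ψ - π / 2 + 2 * π), (0 : ℝ) := by
    refine integral_congr fun θ hθ => ?_
    rw [Set.uIcc_of_le (by linarith [pi_pos])] at hθ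
    simp only [h, sub_zero]
    exact max_eq_right (mul_nonpos_of_nonneg_of_nonpos (norm_nonneg _)
      (cos_nonpos_of_pi_div_two_le_of_le (by linarith [hθ.1]) (by linarith [hθ.2])))
  rw [e1, e2, integral_const_mul, integral_comp_sub_right (fun θ => cos θ), integral_cos]
  simp
  ring

/-- The support function of a finite point set, as a function of the angle of the direction. -/
noncomputable def supportFn (S : Finset Plane) (hS : S.Nonempty) (θ : ℝ) : ℝ :=
  S.sup' hS (dirDot θ)

/-! ### Support functions and Cauchy's formula -/

section Support

variable {S T : Finset Plane} (hS : S.Nonempty) (hT : T.Nonempty)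

theorem continuous_supportFn : Continuous (supportFn S hS) :=
  Continuous.finset_sup'_apply hS fun x _ => continuous_dirDot x

theorem periodic_supportFn : Function.Periodic (supportFn S hS) (2 * π) := fun θ =>
  Finset.sup'_congr hS rfl fun x _ => periodic_dirDot x θ

theorem dirDot_le_supportFn {x : Plane} (hx : x ∈ convexHull ℝ (S : Set Plane)) (θ : ℝ) :
    dirDot θ x ≤ supportFn S hS θ :=
  convexHull_min (t := {y | dirDot θ y ≤ supportFn S hS θ})
    (fun _ hy => Finset.le_sup' (dirDot θ) hy)
    (convex_halfSpace_le (dirDot θ).isLinear _) hx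

theorem supportFn_add_pi (θ : ℝ) : supportFn S hS (θ + π) = - S.inf' hS (dirDot θ) := by
  refine le_antisymm (Finset.sup'_le _ _ fun x hx => ?_) (neg_le.1 (Finset.le_inf' _ _ fun x hx => ?_))
  · rw [dirDot_add_pi, neg_le_neg_iff]
    exact Finset.inf'_le _ hx
  · rw [neg_le, ← dirDot_add_pi]
    exact Finset.le_sup' (dirDot (θ + π)) hx

/-- Cauchy's formula for the perimeter. -/
theorem per_eq_integral : per S = ∫ θ in 0..2 * π, supportFn S hS θ := by
  classical
  have hc := continuous_supportFn hS
  have h1 : ∫ θ in 0..2 * π, supportFn S hS (θ + π) = ∫ θ in 0..2 * π, supportFn S hS θ := by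
    rw [integral_comp_add_right (supportFn S hS)]
    have := (periodic_supportFn hS).intervalIntegral_add_eq π 0
    rw [zero_add, add_comm (2 * π), this, zero_add]
  -- Both sides are the integral of the width: edge by edge it is twice the perimeter, and as `h(θ)
  -- + h(θ + π)` it is twice the integral of `h`.
  have h2 : 2 * per S = 2 * ∫ θ in 0..2 * π, supportFn S hS θ := by
    calc 2 * per S
        = ∑ e ∈ (S ×ˢ S).filter (fun e => IsHullEdge S e.1 e.2),
            ∫ θ in 0..2 * π, max (dirDot θ (e.2 - e.1)) 0 := by
          rw [per, Finset.mul_sum]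
          refine Finset.sum_congr (by congr) fun e _ => ?_
          rw [integral_max_dirDot, dist_comm, dist_eq_norm]
      _ = ∫ θ in 0..2 * π, (supportFn S hS θ + supportFn S hS (θ + π)) := by
          rw [← integral_finsetSum fun e _ =>
            ((continuous_dirDot (e.2 - e.1)).max continuous_const).intervalIntegrable _ _]
          refine integral_congr fun θ _ => ?_
          simp only [supportFn_add_pi, ← sub_eq_add_neg]
          rw [supportFn, ← sum_hullEdge_max (isFrame_dirDot θ) hS]
      _ = 2 * ∫ θ in 0..2 * π, supportFn S hS θ := by
          rw [integral_add (g := fun θ => supportFn S hS (θ + π)) (hc.intervalIntegrable _ _)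
            ((hc.comp (continuous_add_const π)).intervalIntegrable _ _), h1]
          ring
  linarith

theorem integral_dirDot (x : Plane) : ∫ θ in 0..2 * π, dirDot θ x = 0 := by
  simp only [dirDot_apply]
  rw [integral_add (by apply Continuous.intervalIntegrable; fun_prop)
    (by apply Continuous.intervalIntegrable; fun_prop), integral_const_mul, integral_const_mul]
  simp

/-- A hull contained in a disk of radius `r` has perimeter at most `2 π r`. -/
theorem per_le_of_dist_le {S : Finset Plane} (hS : S.Nonempty) {o : Plane} {r : ℝ} (h : ∀ x ∈ S, ‖x - o‖ ≤ r) : per S ≤ 2 * π * r := by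
  have hb : ∀ θ, supportFn S hS θ ≤ r + dirDot θ o := fun θ => Finset.sup'_le _ _ fun x hx => by
    have h1 := dirDot_le_norm θ (x - o)
    rw [map_sub] at h1
    linarith [h x hx]
  have hi : IntervalIntegrable (fun θ => r + dirDot θ o) MeasureTheory.volume 0 (2 * π) :=
    (continuous_const.add (continuous_dirDot o)).intervalIntegrable _ _
  calc per S ≤ ∫ θ in 0..2 * π, (r + dirDot θ o) := by
        rw [per_eq_integral hS]
        exact integral_mono_on (by positivity) ((continuous_supportFn hS).intervalIntegrable _ _) hi
          fun θ _ => hb θ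
    _ = 2 * π * r := by
        rw [integral_add (by simp) ((continuous_dirDot o).intervalIntegrable _ _), integral_dirDot]
        simp

/-- Removing the point farthest from another point shortens the perimeter. -/
theorem exists_per_erase_lt [DecidableEq Plane] (hne : 1 < S.card) :
    ∃ v ∈ S, (S.erase v).Nonempty ∧ per (S.erase v) < per S := by
  have hS : S.Nonempty := Finset.card_pos.1 (by omega)
  obtain ⟨w, hw⟩ := hS
  obtain ⟨v, hv, hmax⟩ := S.exists_max_image (fun x => ‖x - w‖) ⟨w, hw⟩
  obtain ⟨z, hz, hzw⟩ := Finset.exists_mem_ne hne w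
  have hpos : 0 < ‖v - w‖ := (norm_pos_iff.2 (sub_ne_zero.2 hzw)).trans_le (hmax z hz)
  have hvw : v ≠ w := by rintro rfl; simp at hpos
  have hE : (S.erase v).Nonempty := ⟨w, by simp [hvw.symm, hw]⟩
  refine ⟨v, hv, hE, ?_⟩
  rw [per_eq_integral hE, per_eq_integral ⟨w, hw⟩]
  -- The frame angle `π` puts the direction `ψ + π` of `v - w` into the integration range. There `v`
  -- is the only maximizer, so erasing it strictly lowers the support function.
  obtain ⟨ψ, hψ1, hψ2, hψ⟩ := exists_polar π (v - w)
  refine integral_lt_integral_of_continuousOn_of_le_of_exists_lt (by positivity)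
    (continuous_supportFn _).continuousOn (continuous_supportFn _).continuousOn
    (fun θ _ => Finset.sup'_mono _ (Finset.erase_subset _ _) _)
    ⟨ψ + π, ⟨by linarith, by linarith⟩, ?_⟩
  refine (Finset.sup'_lt_iff _).2 fun x hx => ?_
  rw [Finset.mem_erase] at hx
  refine lt_of_lt_of_le ?_ (Finset.le_sup' (dirDot (ψ + π)) hv)
  have h1 : dirDot (ψ + π) (v - w) = ‖v - w‖ := by rw [hψ]; simp
  obtain ⟨τ, -, -, hτ⟩ := exists_polar (ψ + π) (x - w)
  have h2 : dirDot (ψ + π) (x - w) < ‖v - w‖ := by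
    refine lt_of_le_of_ne ((dirDot_le_norm _ _).trans (hmax x hx.2)) fun he => hx.1 ?_
    have h4 := hτ (ψ + π)
    rw [he, sub_self, zero_sub, cos_neg] at h4
    have h3 : ‖x - w‖ = ‖v - w‖ := le_antisymm (hmax x hx.2) (he ▸ dirDot_le_norm _ _)
    have h5 : cos τ = 1 := by
      rw [h3] at h4
      exact mul_left_cancel₀ hpos.ne' (by linarith)
    have h6 : sin τ = 0 := by
      have := sin_sq_add_cos_sq τ
      rw [h5] at this
      exact pow_eq_zero_iff (two_ne_zero) |>.1 (by linarith)
    have h7 : x - w = v - w := by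
      refine (isFrame_dirDot (ψ + π)).ext (he.trans h1.symm) ?_
      rw [hτ, hψ, show ψ + π + π / 2 - (ψ + π) - τ = π / 2 - τ by ring, cos_pi_div_two_sub, h6,
        show ψ + π + π / 2 - π - ψ = π / 2 by ring, cos_pi_div_two]
      simp
    exact sub_left_injective h7
  simp only [map_sub] at h1 h2
  linarith

/-- The perimeter saved by merging two sets is the integral of the smaller support function. -/
theorem per_add_per_sub_per_union [DecidableEq Plane] :
    per S + per T - per (S ∪ T) = ∫ θ in 0..2 * π, min (supportFn S hS θ) (supportFn T hT θ) := by
  have h1 := (continuous_supportFn hS).intervalIntegrable (μ := MeasureTheory.volume) 0 (2 * π)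
  have h2 := (continuous_supportFn hT).intervalIntegrable (μ := MeasureTheory.volume) 0 (2 * π)
  have h3 := (continuous_supportFn (hS.mono (Finset.subset_union_left (s₂ := T)))).intervalIntegrable
    (μ := MeasureTheory.volume) 0 (2 * π)
  rw [per_eq_integral hS, per_eq_integral hT,
    per_eq_integral (hS.mono (Finset.subset_union_left (s₂ := T))),
    ← integral_add h1 h2, ← integral_sub (h1.add h2) h3]
  refine integral_congr fun θ _ => ?_
  simp only [supportFn]
  rw [Finset.sup'_union hS hT, sub_eq_iff_eq_add, ← min_add_max]

end Support

/-- A singleton has perimeter zero, so a bipartition that splits off one well-chosen point already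
beats `per P`; the minimal one does too. -/
theorem integral_min_supportFn_neg {P P₁ P₂ : Finset Plane} (h : IsMinPerimeterSum P P₁ P₂) :
    ∫ θ in 0..2 * π, min (supportFn P₁ h.1.1 θ) (supportFn P₂ h.1.2.1 θ) < 0 := by
  classical
  obtain ⟨⟨h1, h2, hd, hu⟩, hm⟩ := h
  obtain rfl : P₁ ∪ P₂ = P := Finset.coe_injective (by rw [Finset.coe_union, hu])
  have hcard : 1 < (P₁ ∪ P₂).card := by
    rw [Finset.card_union_of_disjoint hd]
    have := h1.card_pos
    have := h2.card_pos
    omega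
  obtain ⟨v, hv, hne, hlt⟩ := exists_per_erase_lt hcard
  have h3 := hm {v} ((P₁ ∪ P₂).erase v) ⟨by simp, hne, by simp, by
    rw [← Finset.coe_union, ← Finset.insert_eq, Finset.insert_erase hv]⟩
  have h4 : per {v} ≤ 2 * π * 0 := per_le_of_dist_le (Finset.singleton_nonempty v) (o := v) (by simp)
  rw [← per_add_per_sub_per_union]
  linarith

/-! ### Existence of the two inner tangents -/

section Tangents

theorem det2_eq_dirDot_of_polar {d : Plane} {φ : ℝ} (h0 : d 0 = cos φ) (h1 : d 1 = sin φ) (v : Plane) :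
    det2 d v = dirDot (φ + π / 2) v := by
  simp only [det2, dirDot_apply, h0, h1, cos_add_pi_div_two, sin_add_pi_div_two]
  ring

theorem exists_polar_of_norm_one {d : Plane} (hd : ‖d‖ = 1) :
    ∃ φ, d 0 = cos φ ∧ d 1 = sin φ := by
  obtain ⟨φ, -, -, h⟩ := exists_polar 0 d
  refine ⟨φ, ?_, ?_⟩
  · simpa [dirDot_apply, hd] using h 0
  · simpa [dirDot_apply, hd, cos_pi_div_two_sub] using h (π / 2)

theorem exists_dirDot_lt {A B : Set Plane} (hA : Convex ℝ A) (hB : Convex ℝ B) (hAc : IsCompact A)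
    (hBc : IsCompact B) (hd : Disjoint A B) :
    ∃ θ, ∀ x ∈ A, ∀ y ∈ B, dirDot θ y < dirDot θ x := by
  obtain ⟨f, u, v, h1, h2, h3⟩ := geometric_hahn_banach_compact_closed hB hBc hA hAc.isClosed hd.symm
  set w : Plane := !₂[f !₂[1, 0], f !₂[0, 1]] with hw
  obtain ⟨ψ, -, -, hψ⟩ := exists_polar 0 w
  have hf : ∀ x, f x = ‖w‖ * dirDot ψ x := fun x => by
    have hx : x = x 0 • !₂[1, 0] + x 1 • !₂[0, 1] := by
      ext i; fin_cases i <;> simp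
    have w0 : w 0 = ‖w‖ * cos ψ := by simpa [dirDot_apply] using hψ 0
    have w1 : w 1 = ‖w‖ * sin ψ := by
      simpa [dirDot_apply, cos_pi_div_two_sub] using hψ (π / 2)
    have : f x = x 0 * w 0 + x 1 * w 1 := by
      conv_lhs => rw [hx]
      simp [hw]
    rw [this, w0, w1, dirDot_apply]
    ring
  refine ⟨ψ, fun x hx y hy => ?_⟩
  have h := (h1 y hy).trans (h2.trans (h3 x hx))
  rw [hf, hf] at h
  exact lt_of_mul_lt_mul_left h (norm_nonneg _)

variable {S T : Finset Plane}

theorem isInnerTangent_of_supportFn_add_eq_zero (hS : S.Nonempty) (hT : T.Nonempty) {φ : ℝ}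
    (h : supportFn S hS (φ + π / 2 + π) + supportFn T hT (φ + π / 2) = 0) :
    ∃ a, IsInnerTangent (convexHull ℝ (S : Set Plane)) (convexHull ℝ (T : Set Plane)) a
      !₂[cos φ, sin φ] := by
  have hdet : ∀ v, det2 !₂[cos φ, sin φ] v = dirDot (φ + π / 2) v :=
    det2_eq_dirDot_of_polar (by simp) (by simp)
  obtain ⟨a, ha, hae⟩ := S.exists_mem_eq_sup' hS (dirDot (φ + π / 2 + π))
  obtain ⟨b, hb, hbe⟩ := T.exists_mem_eq_sup' hT (dirDot (φ + π / 2))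
  have hab : dirDot (φ + π / 2) a = dirDot (φ + π / 2) b := by
    rw [supportFn, supportFn, hae, hbe, dirDot_add_pi] at h
    linarith
  refine ⟨a, ?_, fun x hx => ?_, fun y hy => ?_, ⟨a, subset_convexHull ℝ _ ha, ?_⟩,
    ⟨b, subset_convexHull ℝ _ hb, ?_⟩⟩
  · simp [EuclideanSpace.norm_eq]
  · have := dirDot_le_supportFn hS hx (φ + π / 2 + π)
    rw [supportFn, hae, dirDot_add_pi, dirDot_add_pi] at this
    rw [hdet, map_sub]
    linarith
  · have := dirDot_le_supportFn hT hy (φ + π / 2)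
    rw [supportFn, hbe] at this
    rw [hdet, map_sub]
    linarith
  · rw [sub_self, hdet, map_zero]
  · rw [hdet, map_sub, hab, sub_self]

/-- Disjoint hulls have two inner common tangents. -/
theorem exists_isSeparationAngle (hS : S.Nonempty) (hT : T.Nonempty)
    (hd : Disjoint (convexHull ℝ (S : Set Plane)) (convexHull ℝ (T : Set Plane))) :
    ∃ β, IsSeparationAngle (convexHull ℝ (S : Set Plane)) (convexHull ℝ (T : Set Plane)) β := by
  obtain ⟨θ₀, hθ₀⟩ := exists_dirDot_lt (convex_convexHull ℝ _) (convex_convexHull ℝ _)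
    (S.finite_toSet.isCompact_convexHull ℝ) (T.finite_toSet.isCompact_convexHull ℝ) hd
  -- `-k θ` is the signed gap between the hulls in direction `θ`; zeros of `k` are normals of inner
  -- tangents. It changes sign on either side of `θ₀`, and the two zeros differ by less than `2π`.
  set k : ℝ → ℝ := fun θ => supportFn S hS (θ + π) + supportFn T hT θ with hk
  have hkc : Continuous k := by
    have h1 := continuous_supportFn hS
    have h2 := continuous_supportFn hT
    fun_prop
  have hk0 : k θ₀ < 0 := by
    obtain ⟨a, ha, hae⟩ := S.exists_mem_eq_sup' hS (dirDot (θ₀ + π))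
    obtain ⟨b, hb, hbe⟩ := T.exists_mem_eq_sup' hT (dirDot θ₀)
    have := hθ₀ a (subset_convexHull ℝ _ ha) b (subset_convexHull ℝ _ hb)
    simp only [hk, supportFn]
    rw [hae, hbe, dirDot_add_pi]
    linarith
  have hkpos : ∀ θ, (∀ x, dirDot θ x = - dirDot θ₀ x) → 0 < k θ := fun θ h => by
    obtain ⟨a, ha⟩ := id hS
    obtain ⟨b, hb⟩ := id hT
    have h1 := dirDot_le_supportFn hS (subset_convexHull ℝ _ ha) (θ + π)
    have h2 := dirDot_le_supportFn hT (subset_convexHull ℝ _ hb) θ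
    have := hθ₀ a (subset_convexHull ℝ _ ha) b (subset_convexHull ℝ _ hb)
    rw [dirDot_add_pi, h] at h1
    rw [h] at h2
    simp only [hk]
    linarith
  have hk1 := hkpos (θ₀ + π) (dirDot_add_pi θ₀)
  have hk2 := hkpos (θ₀ - π) fun x => by
    rw [← neg_eq_iff_eq_neg, ← dirDot_add_pi, sub_add_cancel]
  obtain ⟨θ₁, h1, hz1⟩ := intermediate_value_Icc (by linarith [pi_pos] : θ₀ ≤ θ₀ + π)
    hkc.continuousOn ⟨hk0.le, hk1.le⟩
  obtain ⟨θ₂, h2, hz2⟩ := intermediate_value_Icc' (by linarith [pi_pos] : θ₀ - π ≤ θ₀)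
    hkc.continuousOn ⟨hk0.le, hk2.le⟩
  have l1 : θ₀ < θ₁ := lt_of_le_of_ne h1.1 (by rintro rfl; linarith)
  have l2 : θ₂ < θ₀ := lt_of_le_of_ne h2.2 (by rintro rfl; linarith)
  have l3 : θ₁ < θ₀ + π := lt_of_le_of_ne h1.2 (by rintro rfl; linarith)
  have l4 : θ₀ - π < θ₂ := lt_of_le_of_ne h2.1 (by rintro rfl; linarith)
  obtain ⟨a₁, ha₁⟩ := isInnerTangent_of_supportFn_add_eq_zero hS hT (φ := θ₁ - π / 2)
    (by simpa [hk] using hz1)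
  obtain ⟨a₂, ha₂⟩ := isInnerTangent_of_supportFn_add_eq_zero hS hT (φ := θ₂ - π / 2)
    (by simpa [hk] using hz2)
  refine ⟨_, a₁, _, a₂, _, ha₁, ha₂, fun he => ?_, rfl⟩
  have e0 : cos (θ₁ - π / 2) = cos (θ₂ - π / 2) := by simpa using congrFun (congrArg WithLp.ofLp he) 0
  have e1 : sin (θ₁ - π / 2) = sin (θ₂ - π / 2) := by simpa using congrFun (congrArg WithLp.ofLp he) 1
  have hcos : cos (θ₁ - θ₂) = 1 := by
    rw [show θ₁ - θ₂ = (θ₁ - π / 2) - (θ₂ - π / 2) by ring, cos_sub, e0, e1]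
    nlinarith [sin_sq_add_cos_sq (θ₂ - π / 2)]
  have := (cos_eq_one_iff_of_lt_of_lt (by linarith) (by linarith)).1 hcos
  linarith

end Tangents

/-! ### Coordinates at the crossing point of the tangents -/

section Wedge

/-- `A` and `B` lie in opposite wedges with apex `o`, bounded by two lines with normal directions
`c` and `c + β`, and both of them touch both lines. -/
def InOppositeWedges (A B : Set Plane) (o : Plane) (c β : ℝ) : Prop :=
  (∀ x ∈ A, dirDot c (x - o) ≤ 0 ∧ dirDot (c + β) (x - o) ≤ 0) ∧
  (∀ y ∈ B, 0 ≤ dirDot c (y - o) ∧ 0 ≤ dirDot (c + β) (y - o)) ∧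
  (∃ x ∈ A, dirDot c (x - o) = 0) ∧ (∃ x ∈ A, dirDot (c + β) (x - o) = 0) ∧
  (∃ y ∈ B, dirDot c (y - o) = 0) ∧ (∃ y ∈ B, dirDot (c + β) (y - o) = 0)

theorem InOppositeWedges.symm {A B : Set Plane} {o : Plane} {c β : ℝ}
    (h : InOppositeWedges A B o c β) : InOppositeWedges B A o (c + π) β := by
  simpa only [InOppositeWedges, add_right_comm c π β, dirDot_add_pi, neg_eq_zero, Left.neg_nonpos_iff,
    Left.nonneg_neg_iff] using ⟨h.2.1, h.1, h.2.2.2.2.1, h.2.2.2.2.2, h.2.2.1, h.2.2.2.1⟩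

theorem inOppositeWedges_of_isInnerTangent {A B : Set Plane} {a₁ d₁ a₂ d₂ : Plane}
    (h1 : IsInnerTangent A B a₁ d₁) (h2 : IsInnerTangent A B a₂ d₂) (hdet : 0 < det2 d₂ d₁) :
    ∃ o c, InOppositeWedges A B o c (InnerProductGeometry.angle d₁ d₂) := by
  obtain ⟨hn1, hA1, hB1, hta1, htb1⟩ := h1
  obtain ⟨hn2, hA2, hB2, hta2, htb2⟩ := h2
  obtain ⟨φ, p0, p1⟩ := exists_polar_of_norm_one hn2
  obtain ⟨φ', q0, q1⟩ := exists_polar_of_norm_one hn1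
  set β := InnerProductGeometry.angle d₁ d₂ with hβ
  have hcos : cos β = cos (φ' - φ) := by
    rw [hβ, InnerProductGeometry.cos_angle, hn1, hn2, cos_sub, ← p0, ← p1, ← q0, ← q1]
    simp [EuclideanSpace.inner_eq_star_dotProduct, dotProduct, Fin.sum_univ_two]
    ring
  have hdet' : det2 d₂ d₁ = sin (φ' - φ) := by
    rw [det2, p0, p1, q0, q1, sin_sub]; ring
  rw [hdet'] at hdet
  have hsin : sin β = sin (φ' - φ) := by
    have h0 : 0 ≤ sin β := InnerProductGeometry.sin_angle_nonneg _ _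
    have := sin_sq_add_cos_sq β
    rw [hcos, ← sin_sq_add_cos_sq (φ' - φ)] at this
    exact (sq_eq_sq₀ h0 hdet.le).1 (by linarith)
  have q0' : d₁ 0 = cos (φ + β) := by
    rw [cos_add, hcos, hsin, ← cos_add, q0]; ring_nf
  have q1' : d₁ 1 = sin (φ + β) := by
    rw [sin_add, hcos, hsin, ← sin_add, q1]; ring_nf
  have hsb : 0 < sin β := hsin ▸ hdet
  set c := φ - π / 2 with hc
  have hd2 : ∀ v, det2 d₂ v = - dirDot c v := fun v => by
    rw [det2_eq_dirDot_of_polar p0 p1, ← dirDot_add_pi, hc]; ring_nf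
  have hd1 : ∀ v, det2 d₁ v = - dirDot (c + β) v := fun v => by
    rw [det2_eq_dirDot_of_polar q0' q1', ← dirDot_add_pi, hc]; ring_nf
  set u := dirDot c a₂
  set w := dirDot (c + β) a₁
  obtain ⟨o, ho2, ho1⟩ : ∃ o : Plane, dirDot c o = u ∧ dirDot (c + β) o = w := by
    have hs : sin β = sin (c + β) * cos c - cos (c + β) * sin c := by rw [← sin_sub]; ring_nf
    -- Cramer's rule for the intersection of the two tangents.
    refine ⟨!₂[(u * sin (c + β) - w * sin c) / sin β, (w * cos c - u * cos (c + β)) / sin β],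
      ?_, ?_⟩ <;>
    · simp only [dirDot_apply]
      simp
      field_simp
      rw [hs]
      ring
  have e1 : ∀ x, det2 d₁ (x - a₁) = - dirDot (c + β) (x - o) := fun x => by
    rw [hd1, map_sub, map_sub, ho1]
  have e2 : ∀ x, det2 d₂ (x - a₂) = - dirDot c (x - o) := fun x => by
    rw [hd2, map_sub, map_sub, ho2]
  simp only [e1, e2, neg_eq_zero, Left.neg_nonpos_iff, Left.nonneg_neg_iff] at *
  exact ⟨o, c, fun x hx => ⟨hA2 x hx, hA1 x hx⟩, fun x hx => ⟨hB2 x hx, hB1 x hx⟩,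
    hta2, hta1, htb2, htb1⟩

theorem det2_ne_zero_of_angle {d₁ d₂ : Plane} (h1 : ‖d₁‖ = 1) (h2 : ‖d₂‖ = 1) (hne : d₁ ≠ d₂)
    (hlt : InnerProductGeometry.angle d₁ d₂ < π) : det2 d₂ d₁ ≠ 0 := by
  intro h
  obtain ⟨φ, p0, p1⟩ := exists_polar_of_norm_one h2
  obtain ⟨φ', q0, q1⟩ := exists_polar_of_norm_one h1
  have hin : inner ℝ d₁ d₂ = cos (φ' - φ) := by
    rw [cos_sub, ← p0, ← p1, ← q0, ← q1]
    simp [EuclideanSpace.inner_eq_star_dotProduct, dotProduct, Fin.sum_univ_two]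
    ring
  have hs : sin (φ' - φ) = 0 := by
    rw [← h, det2, p0, p1, q0, q1, sin_sub]; ring
  rcases sin_eq_zero_iff_cos_eq.1 hs with hc | hc
  · exact hne ((inner_eq_one_iff_of_norm_eq_one h1 h2).1 (hin.trans hc))
  · rw [InnerProductGeometry.angle, hin, hc, h1, h2] at hlt
    simp at hlt

theorem dirDot_interpolation (c β θ : ℝ) (v : Plane) :
    dirDot (c + θ) v * sin β = dirDot c v * sin (β - θ) + dirDot (c + β) v * sin θ := by
  simp only [dirDot_apply, cos_add, sin_add, sin_sub]
  ring

theorem exists_dirDot_eq_norm (c : ℝ) (v : Plane) : ∃ θ, dirDot (c + θ) v = ‖v‖ := by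
  obtain ⟨ψ, -, -, h⟩ := exists_polar c v
  exact ⟨ψ, by simp [h]⟩

/-- A vector on a bounding line contributes a sinusoid vanishing at the normal of that line; only
the lower bound on its amplitude is needed. -/
theorem exists_dirDot_eq_mul_sin_sub {c β : ℝ} {v : Plane} (hβ : 0 < sin β)
    (h0 : dirDot (c + β) v = 0) (h1 : dirDot c v ≤ 0) :
    ∃ s, ‖v‖ ≤ s ∧ ∀ θ, dirDot (c + θ) v = s * sin (θ - β) := by
  have h : ∀ θ, dirDot (c + θ) v = - dirDot c v / sin β * sin (θ - β) := fun θ => by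
    have := dirDot_interpolation c β θ v
    rw [h0, ← neg_sub θ β, sin_neg] at this
    field_simp
    linarith
  refine ⟨_, ?_, h⟩
  obtain ⟨θ, hθ⟩ := exists_dirDot_eq_norm c v
  rw [← hθ, h]
  exact mul_le_of_le_one_right (div_nonneg (by linarith) hβ.le) (sin_le_one _)

theorem exists_dirDot_eq_mul_sin {c β : ℝ} {v : Plane} (hβ : 0 < sin β)
    (h0 : dirDot c v = 0) (h1 : 0 ≤ dirDot (c + β) v) :
    ∃ s, ‖v‖ ≤ s ∧ ∀ θ, dirDot (c + θ) v = s * sin θ := by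
  have h : ∀ θ, dirDot (c + θ) v = dirDot (c + β) v / sin β * sin θ := fun θ => by
    have := dirDot_interpolation c β θ v
    rw [h0] at this
    field_simp
    linarith
  refine ⟨_, ?_, h⟩
  obtain ⟨θ, hθ⟩ := exists_dirDot_eq_norm c v
  rw [← hθ, h]
  exact mul_le_of_le_one_right (div_nonneg h1 hβ.le) (sin_le_one _)

/-- A point of the wedge in polar coordinates. -/
theorem exists_polar_of_wedge {c β : ℝ} (hπ : β < π) {v : Plane}
    (h1 : dirDot c v ≤ 0) (h2 : dirDot (c + β) v ≤ 0) :
    ∃ ψ, β ≤ ψ ∧ ψ ≤ π ∧ ∀ θ, dirDot (c + θ) v = ‖v‖ * sin (θ - ψ) := by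
  obtain ⟨ψ, hl, hu, h⟩ := exists_polar (c + π / 2) v
  have h' : ∀ θ, dirDot (c + θ) v = ‖v‖ * sin (θ - ψ) := fun θ => by
    rw [h, ← cos_sub_pi_div_two]; ring_nf
  rcases eq_or_ne v 0 with rfl | hv
  · exact ⟨β, le_rfl, hπ.le, by simp⟩
  have hvpos := norm_pos_iff.2 hv
  have s1 : 0 ≤ sin ψ := by
    have := h' 0
    rw [add_zero, zero_sub, sin_neg] at this
    exact nonneg_of_mul_nonneg_right (by linarith : 0 ≤ ‖v‖ * sin ψ) hvpos
  have s2 : 0 ≤ sin (ψ - β) := by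
    have := h' β
    rw [← neg_sub ψ β, sin_neg] at this
    exact nonneg_of_mul_nonneg_right (by linarith : 0 ≤ ‖v‖ * sin (ψ - β)) hvpos
  have hψ0 : 0 ≤ ψ := by
    by_contra! hneg
    linarith [sin_neg_of_neg_of_neg_pi_lt hneg hl]
  refine ⟨ψ, ?_, hu, h'⟩
  by_contra! hlt
  linarith [sin_neg_of_neg_of_neg_pi_lt (by linarith : ψ - β < 0) (by linarith)]

end Wedge

/-! ### Lower bounds for the integral of the minimum -/

theorem sin_le_sin_of_add_le_pi {s t : ℝ} (h : s ≤ t) (hs : 0 ≤ s) (hst : s + t ≤ π) :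
    sin s ≤ sin t := by
  have h1 : 0 ≤ sin ((t - s) / 2) := sin_nonneg_of_nonneg_of_le_pi (by linarith) (by linarith)
  have h2 : 0 ≤ cos ((t + s) / 2) := cos_nonneg_of_mem_Icc ⟨by linarith, by linarith⟩
  have := sin_sub_sin t s
  nlinarith [mul_nonneg h1 h2]

/-- The integral over the lens in which two sine waves overlap. -/
theorem le_integral_of_lens_le {F : ℝ → ℝ} (hF : Continuous F) {a c m : ℝ} (hac : a ≤ c)
    (hπ : c - a ≤ π)
    (h : ∀ θ ∈ Set.Icc a c, m * min (sin (θ - a)) (sin (c - θ)) ≤ F θ) :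
    2 * m * (1 - cos ((c - a) / 2)) ≤ ∫ θ in a..c, F θ := by
  rw [← integral_add_adjacent_intervals (b := (a + c) / 2) (hF.intervalIntegrable _ _)
    (hF.intervalIntegrable _ _)]
  have h1 : m * (1 - cos ((c - a) / 2)) ≤ ∫ θ in a..(a + c) / 2, F θ := by
    calc m * (1 - cos ((c - a) / 2)) = ∫ θ in a..(a + c) / 2, m * sin (θ - a) := by
          rw [integral_const_mul, integral_comp_sub_right (fun θ => sin θ), integral_sin, sub_self,
            cos_zero]
          ring_nf
      _ ≤ _ := by
          refine integral_mono_on (by linarith) (Continuous.intervalIntegrable (by fun_prop) _ _)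
            (hF.intervalIntegrable _ _) fun θ hθ => ?_
          refine le_trans (le_of_eq ?_) (h θ ⟨hθ.1, by linarith [hθ.2]⟩)
          rw [min_eq_left (sin_le_sin_of_add_le_pi (by linarith [hθ.2]) (by linarith [hθ.1])
            (by linarith))]
  have h2 : m * (1 - cos ((c - a) / 2)) ≤ ∫ θ in (a + c) / 2..c, F θ := by
    calc m * (1 - cos ((c - a) / 2)) = ∫ θ in (a + c) / 2..c, m * sin (c - θ) := by
          rw [integral_const_mul, integral_comp_sub_left (fun θ => sin θ), integral_sin, sub_self,
            cos_zero]
          ring_nf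
      _ ≤ _ := by
          refine integral_mono_on (by linarith) (Continuous.intervalIntegrable (by fun_prop) _ _)
            (hF.intervalIntegrable _ _) fun θ hθ => ?_
          refine le_trans (le_of_eq ?_) (h θ ⟨by linarith [hθ.1], hθ.2⟩)
          rw [min_eq_right (sin_le_sin_of_add_le_pi (by linarith [hθ.1]) (by linarith [hθ.2])
            (by linarith))]
  linarith

theorem mul_min_le_min {m r s x y u v : ℝ} (hm : 0 ≤ m) (hr : m ≤ r) (hs : m ≤ s)
    (hx : 0 ≤ x) (hy : 0 ≤ y) (hu : r * x ≤ u) (hv : s * y ≤ v) : m * min x y ≤ min u v := by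
  refine le_min ?_ ?_
  · exact (mul_le_mul hr (min_le_left _ _) (le_min hx hy) (hm.trans hr)).trans hu
  · exact (mul_le_mul hs (min_le_right _ _) (le_min hx hy) (hm.trans hs)).trans hv

section Overlap

variable {H K : ℝ → ℝ} {β s₁ t₁ s₂ t₂ r₁ r₂ : ℝ}

/-- A lower bound for the integral of the minimum of two support functions, of sets in opposite
wedges whose bounding lines have directions `π / 2` and `β + π / 2`. -/
theorem le_integral_min (hH : Continuous H) (hK : Continuous K) (h0 : 0 < β) (hβ : β < π)
    (hs₁ : 0 ≤ s₁) (ht₁ : 0 ≤ t₁)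
    (hHs : ∀ θ, s₁ * sin (θ - β) ≤ H θ) (hHt : ∀ θ, -(t₁ * sin θ) ≤ H θ)
    (hKs : ∀ θ, s₂ * sin θ ≤ K θ) (hKt : ∀ θ, -(t₂ * sin (θ - β)) ≤ K θ)
    (hHr : ∀ θ, -r₁ ≤ H θ) (hKr : ∀ θ, -r₂ ≤ K θ) (hr₁ : 0 ≤ r₁) (hr₂ : 0 ≤ r₂)
    {m ρ ψ ρ' ψ' : ℝ} (hm : 0 ≤ m) (hms : m ≤ s₂) (hmt : m ≤ t₂) (hmρ : m ≤ ρ) (hmρ' : m ≤ ρ')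
    (hψ : ψ ∈ Set.Icc β π) (hψ' : ψ' ∈ Set.Icc β π)
    (hHψ : ∀ θ, ρ * sin (θ - ψ) ≤ H θ) (hHψ' : ∀ θ, ρ' * sin (θ - ψ') ≤ H θ) :
    2 * m * (1 - cos ((π - ψ) / 2)) + 2 * m * (1 - cos ((ψ' - β) / 2)) - β * (r₁ + r₂) ≤
      ∫ θ in 0..2 * π, min (H θ) (K θ) := by
  have hF : Continuous fun θ => min (H θ) (K θ) := hH.min hK
  set F := fun θ => min (H θ) (K θ) with hFdef
  have hi : ∀ a b, IntervalIntegrable F MeasureTheory.volume a b := fun a b =>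
    hF.intervalIntegrable a b
  -- On `[0, β]` only `H` can be negative and on `[π, π + β]` only `K`. The arcs `[ψ, π]` and `[π +
  -- β, π + ψ']` carry the two lenses; on the other two the minimum is nonnegative.
  have hsplit : ∫ θ in 0..2 * π, F θ = (∫ θ in 0..β, F θ) + (∫ θ in β..ψ, F θ) +
      (∫ θ in ψ..π, F θ) + (∫ θ in π..π + β, F θ) + (∫ θ in π + β..π + ψ', F θ) +
      ∫ θ in π + ψ'..2 * π, F θ := by
    simp only [integral_add_adjacent_intervals (hi _ _) (hi _ _)]
  have hs₂ : 0 ≤ s₂ := hm.trans hms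
  have ht₂ : 0 ≤ t₂ := hm.trans hmt
  have sin_upper : ∀ θ, π ≤ θ → θ ≤ 2 * π → sin θ ≤ 0 := fun θ h1 h2 => by
    have := sin_nonneg_of_nonneg_of_le_pi (by linarith : 0 ≤ θ - π) (by linarith)
    rw [sin_sub_pi] at this
    linarith
  have i1 : -(β * r₁) ≤ ∫ θ in 0..β, F θ := by
    have := integral_mono_on h0.le (intervalIntegrable_const (c := -r₁)) (hi 0 β) fun θ hθ =>
      le_min (hHr θ) ((by linarith [mul_nonneg hs₂ (sin_nonneg_of_nonneg_of_le_pi hθ.1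
        (hθ.2.trans hβ.le))] : -r₁ ≤ s₂ * sin θ).trans (hKs θ))
    rw [integral_const, smul_eq_mul] at this
    linarith
  have i2 : 0 ≤ ∫ θ in β..ψ, F θ := integral_nonneg hψ.1 fun θ hθ => le_min
    ((mul_nonneg hs₁ (sin_nonneg_of_nonneg_of_le_pi (by linarith [hθ.1])
      (by linarith [hθ.2, hψ.2]))).trans (hHs θ))
    ((mul_nonneg hs₂ (sin_nonneg_of_nonneg_of_le_pi (by linarith [hθ.1])
      (by linarith [hθ.2, hψ.2]))).trans (hKs θ))
  have i3 : 2 * m * (1 - cos ((π - ψ) / 2)) ≤ ∫ θ in ψ..π, F θ := by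
    refine le_integral_of_lens_le hF hψ.2 (by linarith [hψ.1]) fun θ hθ => ?_
    refine mul_min_le_min hm hmρ hms (sin_nonneg_of_nonneg_of_le_pi (by linarith [hθ.1])
      (by linarith [hθ.2, hψ.1])) (sin_nonneg_of_nonneg_of_le_pi (by linarith [hθ.2])
      (by linarith [hθ.1, hψ.1])) (hHψ θ) ?_
    rw [sin_pi_sub]
    exact hKs θ
  have i4 : -(β * r₂) ≤ ∫ θ in π..π + β, F θ := by
    have := integral_mono_on (by linarith) (intervalIntegrable_const (c := -r₂)) (hi π (π + β))
      fun θ hθ => le_min ((by linarith [mul_nonneg hs₁ (sin_nonneg_of_nonneg_of_le_pi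
        (by linarith [hθ.1] : 0 ≤ θ - β) (by linarith [hθ.2]))] :
          -r₂ ≤ s₁ * sin (θ - β)).trans (hHs θ)) (hKr θ)
    rw [integral_const, smul_eq_mul] at this
    linarith
  have i5 : 2 * m * (1 - cos ((ψ' - β) / 2)) ≤ ∫ θ in π + β..π + ψ', F θ := by
    have := le_integral_of_lens_le hF (a := π + β) (c := π + ψ') (m := m) (by linarith [hψ'.1])
      (by linarith [hψ'.2]) fun θ hθ => ?_
    · rwa [add_sub_add_left_eq_sub] at this
    · rw [min_comm]
      refine mul_min_le_min hm hmρ' hmt (sin_nonneg_of_nonneg_of_le_pi (by linarith [hθ.2])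
        (by linarith [hθ.1, hψ'.2])) (sin_nonneg_of_nonneg_of_le_pi (by linarith [hθ.1])
        (by linarith [hθ.2, hψ'.2])) ?_ ?_
      · rw [show π + ψ' - θ = π - (θ - ψ') by ring, sin_pi_sub]
        exact hHψ' θ
      · rw [show θ - (π + β) = θ - β - π by ring, sin_sub_pi, mul_neg]
        exact hKt θ
  have i6 : 0 ≤ ∫ θ in π + ψ'..2 * π, F θ := integral_nonneg (by linarith [hψ'.2]) fun θ hθ => le_min
    ((neg_nonneg.2 (mul_nonpos_of_nonneg_of_nonpos ht₁ (sin_upper θ (by linarith [hθ.1, hψ'.1])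
      hθ.2))).trans (hHt θ))
    ((neg_nonneg.2 (mul_nonpos_of_nonneg_of_nonpos ht₂ (sin_upper (θ - β)
      (by linarith [hθ.1, hψ'.1]) (by linarith [hθ.2])))).trans (hKt θ))
  rw [hsplit]
  linarith

theorem cos_add_cos_le_of_lt_pi_div_six {β : ℝ} (h0 : 0 < β) (hβ : β < π / 6) (ψ : ℝ) :
    cos ((π - ψ) / 2) + cos ((ψ - β) / 2) ≤ 8 / 5 := by
  have hc : cos ((π - β) / 4) ≤ 4 / 5 := by
    refine (cos_le_cos_of_nonneg_of_le_pi (by norm_num) (by linarith [pi_pos])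
      (by linarith [pi_gt_d2] : (0.65 : ℝ) ≤ (π - β) / 4)).trans ?_
    have := (abs_le.1 (cos_bound (x := 0.65) (by rw [abs_of_pos] <;> norm_num))).2
    rw [abs_of_pos (by norm_num)] at this
    norm_num at this ⊢
    linarith
  have hc0 : 0 ≤ cos ((π - β) / 4) :=
    cos_nonneg_of_mem_Icc ⟨by linarith [pi_pos], by linarith [pi_pos]⟩
  rw [cos_add_cos, show ((π - ψ) / 2 + (ψ - β) / 2) / 2 = (π - β) / 4 by ring]
  have := mul_le_of_le_one_right hc0 (cos_le_one (((π - ψ) / 2 - (ψ - β) / 2) / 2))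
  linarith

/-- If merging does not save perimeter, the set nearer to the apex lies in a disk that is smaller
than the distance of the other set from the apex. -/
theorem radius_le_of_integral_min_neg (hH : Continuous H) (hK : Continuous K) (h0 : 0 < β)
    (hβ : β < π / 6)
    (hHs : ∀ θ, s₁ * sin (θ - β) ≤ H θ) (hHt : ∀ θ, -(t₁ * sin θ) ≤ H θ)
    (hKs : ∀ θ, s₂ * sin θ ≤ K θ) (hKt : ∀ θ, -(t₂ * sin (θ - β)) ≤ K θ)
    (hHr : ∀ θ, -r₁ ≤ H θ) (hKr : ∀ θ, -r₂ ≤ K θ) (hr₁ : 0 ≤ r₁) (hr : r₁ ≤ r₂)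
    (hs₁ : r₁ ≤ s₁) (ht₁ : r₁ ≤ t₁) (hs₂ : r₂ ≤ s₂) (ht₂ : r₂ ≤ t₂)
    (hneg : ∫ θ in 0..2 * π, min (H θ) (K θ) < 0)
    {ρ ψ : ℝ} (hρ : 0 ≤ ρ) (hψ : ψ ∈ Set.Icc β π) (hHψ : ∀ θ, ρ * sin (θ - ψ) ≤ H θ) :
    ρ ≤ 9 / 10 * r₂ := by
  have hr₂ := hr₁.trans hr
  have hβ' : β < 0.525 := by linarith [pi_lt_d2]
  have hβπ : β < π := by linarith [pi_pos]
  have bound := @le_integral_min H K β s₁ t₁ s₂ t₂ r₁ r₂ hH hK h0 hβπ (hr₁.trans hs₁)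
    (hr₁.trans ht₁) hHs hHt hKs hKt hHr hKr hr₁ hr₂
  -- The tangency points of the nearer set give the two widest possible lenses, of height `r₁`.
  have b1 := @bound r₁ s₁ β t₁ π hr₁ (hr.trans hs₂) (hr.trans ht₂) hs₁ ht₁ ⟨le_rfl, hβπ.le⟩
    ⟨hβπ.le, le_rfl⟩ hHs fun θ => by rw [sin_sub_pi, mul_neg]; exact hHt θ
  have hsin : cos ((π - β) / 2) ≤ 0.2625 := by
    rw [show (π - β) / 2 = π / 2 - β / 2 by ring, cos_pi_div_two_sub]
    linarith [sin_le (by linarith : 0 ≤ β / 2)]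
  have c1 : 1.9 * r₁ ≤ 0.525 * r₂ := by
    have k1 : r₁ * cos ((π - β) / 2) ≤ r₁ * 0.2625 := mul_le_mul_of_nonneg_left hsin hr₁
    have k2 : β * (r₁ + r₂) ≤ 0.525 * (r₁ + r₂) :=
      mul_le_mul_of_nonneg_right hβ'.le (by linarith)
    linarith
  by_contra! hlt
  have hm0 : 0 ≤ min ρ r₂ := le_min hρ hr₂
  -- A single far point now serves both lenses. They are worth at least `0.8 * 0.9 r₂ = 0.72 r₂`,
  -- but the loss is at most `0.525 (1 + 0.525 / 1.9) r₂ < 0.68 r₂`.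
  have b2 := @bound (min ρ r₂) ρ ψ ρ ψ hm0 ((min_le_right _ _).trans hs₂)
    ((min_le_right _ _).trans ht₂) (min_le_left _ _) (min_le_left _ _) hψ hψ hHψ hHψ
  have hmge : 9 / 10 * r₂ ≤ min ρ r₂ := le_min hlt.le (by linarith)
  have k1 := mul_le_mul_of_nonneg_left (cos_add_cos_le_of_lt_pi_div_six h0 hβ ψ) hm0
  have k2 : β * (r₁ + r₂) ≤ 0.525 * (r₁ + r₂) :=
    mul_le_mul_of_nonneg_right hβ'.le (by linarith)
  linarith

end Overlap

/-! ### From the integral estimate to the theorem -/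

theorem per_le_dist_of_inOppositeWedges {S T : Finset Plane} (hS : S.Nonempty) (hT : T.Nonempty)
    (hneg : ∫ θ in 0..2 * π, min (supportFn S hS θ) (supportFn T hT θ) < 0)
    {o a b : Plane} {c β : ℝ} (h0 : 0 < β) (hβ : β < π / 6)
    (hW : InOppositeWedges (convexHull ℝ (S : Set Plane)) (convexHull ℝ (T : Set Plane)) o c β)
    (ha : a ∈ convexHull ℝ (S : Set Plane)) (hb : b ∈ convexHull ℝ (T : Set Plane))
    (ha' : ∀ x ∈ convexHull ℝ (S : Set Plane), ‖a - o‖ ≤ ‖x - o‖)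
    (hb' : ∀ y ∈ convexHull ℝ (T : Set Plane), ‖b - o‖ ≤ ‖y - o‖) (hab : ‖a - o‖ ≤ ‖b - o‖)
    {x y : Plane} (hx : x ∈ convexHull ℝ (S : Set Plane)) (hy : y ∈ convexHull ℝ (T : Set Plane)) :
    1 / 250 * per S ≤ dist x y := by
  obtain ⟨hA, hB, ⟨q₁, hq₁, eq₁⟩, ⟨p₁, hp₁, ep₁⟩, ⟨p₂, hp₂, ep₂⟩, ⟨q₂, hq₂, eq₂⟩⟩ := hW
  have hsin : 0 < sin β := sin_pos_of_pos_of_lt_pi h0 (by linarith [pi_pos])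
  obtain ⟨s₁, hs₁, es₁⟩ := exists_dirDot_eq_mul_sin_sub hsin ep₁ (hA p₁ hp₁).1
  obtain ⟨t₁, ht₁, et₁⟩ := exists_dirDot_eq_mul_sin (v := -(q₁ - o)) hsin
    (by rw [map_neg, eq₁, neg_zero]) (by rw [map_neg]; linarith [(hA q₁ hq₁).2])
  obtain ⟨s₂, hs₂, es₂⟩ := exists_dirDot_eq_mul_sin hsin ep₂ (hB p₂ hp₂).2
  obtain ⟨t₂, ht₂, et₂⟩ := exists_dirDot_eq_mul_sin_sub (v := -(q₂ - o)) hsin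
    (by rw [map_neg, eq₂, neg_zero]) (by rw [map_neg]; linarith [(hB q₂ hq₂).1])
  simp only [map_neg, norm_neg] at et₁ ht₁ et₂ ht₂
  set H : ℝ → ℝ := fun θ => supportFn S hS (c + θ) - dirDot (c + θ) o with hH
  set K : ℝ → ℝ := fun θ => supportFn T hT (c + θ) - dirDot (c + θ) o with hK
  have hHle : ∀ {z}, z ∈ convexHull ℝ (S : Set Plane) → ∀ θ, dirDot (c + θ) (z - o) ≤ H θ :=
    fun hz θ => by
      rw [map_sub]
      exact sub_le_sub_right (dirDot_le_supportFn hS hz _) _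
  have hKle : ∀ {z}, z ∈ convexHull ℝ (T : Set Plane) → ∀ θ, dirDot (c + θ) (z - o) ≤ K θ :=
    fun hz θ => by
      rw [map_sub]
      exact sub_le_sub_right (dirDot_le_supportFn hT hz _) _
  have hlow : ∀ θ (z : Plane), -‖z‖ ≤ dirDot θ z := fun θ z => by
    have := dirDot_le_norm θ (-z)
    rw [map_neg, norm_neg] at this
    linarith
  have hadd : Continuous fun θ => c + θ := by fun_prop
  have hHc : Continuous H :=
    ((continuous_supportFn hS).comp hadd).sub ((continuous_dirDot o).comp hadd)
  have hKc : Continuous K :=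
    ((continuous_supportFn hT).comp hadd).sub ((continuous_dirDot o).comp hadd)
  -- Moving the origin to `o` subtracts a sinusoid of integral zero; rotating by `c` only shifts the
  -- period.
  have hint : ∫ θ in 0..2 * π, min (H θ) (K θ) < 0 := by
    have hc := (continuous_supportFn hS).min (continuous_supportFn hT)
    have hper : Function.Periodic
        (fun θ => min (supportFn S hS θ) (supportFn T hT θ) - dirDot θ o) (2 * π) := fun θ => by
      simp only [periodic_supportFn hS θ, periodic_supportFn hT θ, periodic_dirDot o θ]
    calc ∫ θ in 0..2 * π, min (H θ) (K θ)
        = ∫ θ in 0..2 * π, (min (supportFn S hS (c + θ)) (supportFn T hT (c + θ)) -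
            dirDot (c + θ) o) := by simp only [hH, hK, min_sub_sub_right]
      _ = ∫ θ in c + 0..c + 2 * π, (min (supportFn S hS θ) (supportFn T hT θ) - dirDot θ o) :=
          integral_comp_add_left
            (fun θ => min (supportFn S hS θ) (supportFn T hT θ) - dirDot θ o) c
      _ = ∫ θ in 0..2 * π, (min (supportFn S hS θ) (supportFn T hT θ) - dirDot θ o) := by
          rw [add_zero, hper.intervalIntegral_add_eq c 0, zero_add]
      _ < 0 := by
          rw [integral_sub (hc.intervalIntegrable _ _)
            ((continuous_dirDot o).intervalIntegrable _ _), integral_dirDot, sub_zero]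
          exact hneg
  have hrad : ∀ z ∈ convexHull ℝ (S : Set Plane), ‖z - o‖ ≤ 9 / 10 * ‖b - o‖ := fun z hz => by
    obtain ⟨ψ, hψ1, hψ2, hψ⟩ := exists_polar_of_wedge (by linarith [pi_pos]) (hA z hz).1 (hA z hz).2
    refine radius_le_of_integral_min_neg hHc hKc h0 hβ (s₁ := s₁) (t₁ := t₁) (s₂ := s₂) (t₂ := t₂)
      (fun θ => ?_) (fun θ => ?_) (fun θ => ?_) (fun θ => ?_)
      (fun θ => (hlow (c + θ) _).trans (hHle ha θ)) (fun θ => (hlow (c + θ) _).trans (hKle hb θ))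
      (norm_nonneg _) hab ((ha' _ hp₁).trans hs₁) ((ha' _ hq₁).trans ht₁) ((hb' _ hp₂).trans hs₂)
      ((hb' _ hq₂).trans ht₂) hint (norm_nonneg _) ⟨hψ1, hψ2⟩ fun θ => ?_
    · rw [← es₁]; exact hHle hp₁ θ
    · rw [← et₁, neg_neg]; exact hHle hq₁ θ
    · rw [← es₂]; exact hKle hp₂ θ
    · rw [← et₂, neg_neg]; exact hKle hq₂ θ
    · rw [← hψ]; exact hHle hz θ
  have hperS := per_le_of_dist_le hS fun z hz => hrad z (subset_convexHull ℝ _ hz)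
  have hdist : ‖y - o‖ - ‖x - o‖ ≤ dist x y := by
    rw [dist_comm, dist_eq_norm]
    simpa using norm_sub_norm_le (y - o) (x - o)
  have h1 := hrad x hx
  have h2 := hb' y hy
  -- With `π ≤ 4` the perimeter is at most `7.2 ‖b - o‖` and the gap at least `0.1 ‖b - o‖`, so `1 /
  -- 250` leaves ample room.
  have h3 : π * ‖b - o‖ ≤ 4 * ‖b - o‖ := mul_le_mul_of_nonneg_right pi_le_four (norm_nonneg _)
  linarith [norm_nonneg (b - o)]

theorem min_per_le_dist {S T : Finset Plane} (hS : S.Nonempty) (hT : T.Nonempty)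
    (hneg : ∫ θ in 0..2 * π, min (supportFn S hS θ) (supportFn T hT θ) < 0)
    {o : Plane} {c β : ℝ} (h0 : 0 < β) (hβ : β < π / 6)
    (hW : InOppositeWedges (convexHull ℝ (S : Set Plane)) (convexHull ℝ (T : Set Plane)) o c β)
    {x y : Plane} (hx : x ∈ convexHull ℝ (S : Set Plane)) (hy : y ∈ convexHull ℝ (T : Set Plane)) :
    1 / 250 * min (per S) (per T) ≤ dist x y := by
  have hc : Continuous fun z : Plane => ‖z - o‖ := by fun_prop
  obtain ⟨a, ha, ha'⟩ := (S.finite_toSet.isCompact_convexHull ℝ).exists_isMinOn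
    (hS.to_set.mono (subset_convexHull ℝ _)) hc.continuousOn
  obtain ⟨b, hb, hb'⟩ := (T.finite_toSet.isCompact_convexHull ℝ).exists_isMinOn
    (hT.to_set.mono (subset_convexHull ℝ _)) hc.continuousOn
  rcases le_total ‖a - o‖ ‖b - o‖ with hab | hab
  · have := per_le_dist_of_inOppositeWedges hS hT hneg h0 hβ hW ha hb ha' hb' hab hx hy
    linarith [min_le_left (per S) (per T)]
  · have := per_le_dist_of_inOppositeWedges hT hS (by simpa only [min_comm] using hneg) h0 hβ
      hW.symm hb ha hb' ha' hab hy hx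
    rw [dist_comm]
    linarith [min_le_right (per S) (per T)]

theorem disjoint_convexHull_of_integral_min_neg {S T : Finset Plane} (hS : S.Nonempty)
    (hT : T.Nonempty)
    (hneg : ∫ θ in 0..2 * π, min (supportFn S hS θ) (supportFn T hT θ) < 0) :
    Disjoint (convexHull ℝ (S : Set Plane)) (convexHull ℝ (T : Set Plane)) := by
  refine Set.disjoint_left.2 fun z hz hz' => hneg.not_ge ?_
  refine (integral_dirDot z).ge.trans ?_
  exact integral_mono_on two_pi_pos.le ((continuous_dirDot z).intervalIntegrable _ _)
    (((continuous_supportFn hS).min (continuous_supportFn hT)).intervalIntegrable _ _)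
    fun θ _ => le_min (dirDot_le_supportFn hS hz θ) (dirDot_le_supportFn hT hz' θ)

/-- Below `π` the distinct tangent directions are not opposite, so the tangents cross in one point;
the sign of the determinant decides which tangent comes first. -/
theorem IsSeparationAngle.exists_inOppositeWedges {A B : Set Plane} {β : ℝ}
    (h : IsSeparationAngle A B β) (hβ : β < π) : 0 < β ∧ ∃ o c, InOppositeWedges A B o c β := by
  obtain ⟨a₁, d₁, a₂, d₂, h1, h2, hne, rfl⟩ := h
  have hdet := det2_ne_zero_of_angle h1.1 h2.1 hne hβ
  refine ⟨(InnerProductGeometry.angle_nonneg d₁ d₂).lt_of_ne fun h0 => hne ?_, ?_⟩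
  · have hin := InnerProductGeometry.cos_angle d₁ d₂
    rw [← h0, h1.1, h2.1, cos_zero, mul_one, div_one] at hin
    exact (inner_eq_one_iff_of_norm_eq_one h1.1 h2.1).1 hin.symm
  · rcases lt_or_gt_of_ne hdet with hlt | hlt
    · rw [InnerProductGeometry.angle_comm]
      refine inOppositeWedges_of_isInnerTangent h2 h1 ?_
      simp only [det2] at hlt ⊢
      linarith
    · exact inOppositeWedges_of_isInnerTangent h1 h2 hlt

theorem theorem1 (P P₁ P₂ : Finset Plane) (hmin : IsMinPerimeterSum P P₁ P₂) :
    Disjoint (convexHull ℝ (P₁ : Set Plane)) (convexHull ℝ (P₂ : Set Plane)) ∧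
    (∃ β, IsSeparationAngle (convexHull ℝ (P₁ : Set Plane)) (convexHull ℝ (P₂ : Set Plane)) β) ∧
    ∀ β, IsSeparationAngle (convexHull ℝ (P₁ : Set Plane)) (convexHull ℝ (P₂ : Set Plane)) β →
      Real.pi / 6 ≤ β ∨
      1 / 250 * min (per P₁) (per P₂) ≤
        sepDist (convexHull ℝ (P₁ : Set Plane)) (convexHull ℝ (P₂ : Set Plane)) := by
  have hneg := integral_min_supportFn_neg hmin
  have hd := disjoint_convexHull_of_integral_min_neg _ _ hneg
  have h1 := hmin.1.1
  have h2 := hmin.1.2.1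
  refine ⟨hd, exists_isSeparationAngle h1 h2 hd, fun β hβ => ?_⟩
  rcases le_or_gt (Real.pi / 6) β with h | h
  · exact Or.inl h
  refine Or.inr (le_csInf ?_ ?_)
  · obtain ⟨x, hx⟩ := h1
    obtain ⟨y, hy⟩ := h2
    exact ⟨_, x, subset_convexHull ℝ _ hx, y, subset_convexHull ℝ _ hy, rfl⟩
  · rintro r ⟨x, hx, y, hy, rfl⟩
    obtain ⟨h0, o, c, hW⟩ := hβ.exists_inOppositeWedges (by linarith [Real.pi_pos])
    exact min_per_le_dist h1 h2 hneg h0 h hW hx hy
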